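/- Let $T>0$ and $p\ge 1$. Let $\mathbb D=D([0,T],\mathbb R)$ be the set of functions $x:[0,T]\to\mathbb R$ that are right-continuous with left limits and left-continuous at the final time $T$. Let $\Lambda$ be the set of strictly increasing continuous maps of $[0,T]$ onto itself, and equip $\mathbb D$ with the Skorohod metric $$d^o(x,y)=\inf_{\lambda\in\Lambda}\Big\{\sup_{0\le s<t\le T}\Big|\log\frac{\lambda(t)-\lambda(s)}{t-s}\Big|\ \vee\ \sup_{0\le t\le T}|x(t)-y(\lambda(t))|\Big\}$$ and with the corresponding Borel $\sigma$-algebra. For probability measures $P,Q$ on $\mathbb D$ let $$D^o_T(P,Q)=\inf_R\Big(\int_{\mathbb D\times\mathbb D}d^o(x,y)^p\,R(dx,dy)\Big)^{1/p},$$ the infimum being over all probability measures $R$ on $\mathbb D\times\mathbb D$ with marginals $P$ and $Q$. Let $P$ be a probability measure on $\mathbb D$ with $\int_{\mathbb D}d^o(x,0)^p\,P(dx)<\infty$, where $0$ is the zero path, let $\zeta=(\zeta^i)_{i\ge1}$ be i.i.d. $\mathbb D$-valued random variables with law $P$, and let $L^n(\zeta)=\frac1n\sum_{i=1}^n\delta_{\zeta^i}$.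 Then, for every $n\ge1$, $D^o_T(L^n(\zeta),P)$ is a random variable (i.e. measurable) and $$\mathbb E\big[D^o_T(L^n(\zeta),P)^p\big]\le 2^p\,D^o_T(P,\delta_0)^p,$$ and moreover $$\lim_{n\to\infty}\mathbb E\big[D^o_T(L^n(\zeta),P)^p\big]=0.$$ -/

import Mathlib

open Set Filter Topology MeasureTheory
open scoped ENNReal

noncomputable section

/-- The space `𝔻 = D([0,T], ℝ)`: functions on `[0,T]` that are right continuous, have left limits,
and are left continuous at the final time `T`. (On the type `[0,T]` right continuity at `T` and the
left limit at `0` are void.) -/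
@[ext]
structure SkorokhodSpace (T : ℝ) where
  toFun : Icc (0 : ℝ) T → ℝ
  right_cont : ∀ t, ContinuousWithinAt toFun (Ioi t) t
  left_lim : ∀ t, ∃ l, Tendsto toFun (𝓝[<] t) (𝓝 l)
  left_cont_final : ∀ t : Icc (0 : ℝ) T, (t : ℝ) = T → ContinuousWithinAt toFun (Iio t) t

namespace SkorokhodSpace

variable {T : ℝ}

instance : CoeFun (SkorokhodSpace T) (fun _ => Icc (0 : ℝ) T → ℝ) := ⟨toFun⟩

/-- The path that is identically zero. -/
instance : Zero (SkorokhodSpace T) where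
  zero :=
    { toFun := fun _ => 0
      right_cont := fun _ => continuousWithinAt_const
      left_lim := fun _ => ⟨0, tendsto_const_nhds⟩
      left_cont_final := fun _ _ => continuousWithinAt_const }

/-- The class `Λ` of time changes: the strictly increasing (continuous) maps of `[0,T]` onto itself.
These are the order automorphisms of `[0,T]`; continuity is automatic for them
(`OrderIso.continuous`). -/
abbrev TimeChange (T : ℝ) : Type := Icc (0 : ℝ) T ≃o Icc (0 : ℝ) T

/-- `‖lam‖° = sup_{s < t} |log ((lam t - lam s) / (t - s))|`, with values in `[0,∞]`. -/
def logNorm (lam : TimeChange T) : ℝ≥0∞ :=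
  ⨆ (s : Icc (0 : ℝ) T) (t : Icc (0 : ℝ) T) (_ : s < t),
    ENNReal.ofReal |Real.log (((lam t : ℝ) - lam s) / ((t : ℝ) - s))|

/-- `sup_t |x t - y (lam t)|`, with values in `[0,∞]`. -/
def supGap (lam : TimeChange T) (x y : SkorokhodSpace T) : ℝ≥0∞ :=
  ⨆ t : Icc (0 : ℝ) T, ENNReal.ofReal |x t - y (lam t)|

/-- The distance `d°(x,y) = inf_lam max (‖lam‖°, sup_t |x t - y (lam t)|)`; it is finite, see
`skDist_ne_top`. -/
def skDist (x y : SkorokhodSpace T) : ℝ≥0∞ :=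
  ⨅ lam : TimeChange T, max (logNorm lam) (supGap lam x y)

theorem logNorm_refl : logNorm (OrderIso.refl (Icc (0 : ℝ) T)) = 0 := by
  simp only [logNorm, ENNReal.iSup_eq_zero]
  intro s t h
  have h' : (s : ℝ) < t := h
  have : (t : ℝ) - s ≠ 0 := by linarith
  simp [this]

theorem skDist_self (x : SkorokhodSpace T) : skDist x x = 0 := by
  refine le_antisymm ((iInf_le _ (OrderIso.refl _)).trans ?_) bot_le
  simp [logNorm_refl, supGap]

theorem logNorm_symm_le (lam : TimeChange T) : logNorm lam.symm ≤ logNorm lam := by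
  refine iSup_le fun s => iSup_le fun t => iSup_le fun h => ?_
  refine le_trans (le_of_eq ?_)
    (le_iSup_of_le (lam.symm s) (le_iSup_of_le (lam.symm t)
      (le_iSup_of_le (lam.symm.strictMono h) le_rfl)))
  rw [OrderIso.apply_symm_apply, OrderIso.apply_symm_apply, ← inv_div, Real.log_inv, abs_neg]

theorem supGap_symm_le (lam : TimeChange T) (x y : SkorokhodSpace T) :
    supGap lam.symm y x ≤ supGap lam x y := by
  refine iSup_le fun t => le_iSup_of_le (lam.symm t) (le_of_eq ?_)
  rw [OrderIso.apply_symm_apply, abs_sub_comm]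

theorem skDist_comm_le (x y : SkorokhodSpace T) : skDist y x ≤ skDist x y :=
  le_iInf fun lam => (iInf_le _ lam.symm).trans
    (max_le_max (logNorm_symm_le lam) (supGap_symm_le lam x y))

theorem logNorm_trans_le (lam mu : TimeChange T) :
    logNorm (lam.trans mu) ≤ logNorm lam + logNorm mu := by
  refine iSup_le fun s => iSup_le fun t => iSup_le fun h => ?_
  have h1 : (0 : ℝ) < (t : ℝ) - s := sub_pos.2 h
  have h2 : (0 : ℝ) < (lam t : ℝ) - lam s := sub_pos.2 (lam.strictMono h)
  have h3 : (0 : ℝ) < (mu (lam t) : ℝ) - mu (lam s) :=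
    sub_pos.2 (mu.strictMono (lam.strictMono h))
  have e : Real.log (((mu (lam t) : ℝ) - mu (lam s)) / ((t : ℝ) - s)) =
      Real.log (((lam t : ℝ) - lam s) / ((t : ℝ) - s)) +
        Real.log (((mu (lam t) : ℝ) - mu (lam s)) / ((lam t : ℝ) - lam s)) := by
    rw [← Real.log_mul (by positivity) (by positivity)]
    congr 1
    field_simp
  simp only [OrderIso.trans_apply]
  rw [e]
  refine (ENNReal.ofReal_le_ofReal (abs_add_le _ _)).trans
    (ENNReal.ofReal_add_le.trans (add_le_add ?_ ?_))
  · exact le_iSup_of_le s (le_iSup_of_le t (le_iSup_of_le h le_rfl))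
  · exact le_iSup_of_le (lam s) (le_iSup_of_le (lam t)
      (le_iSup_of_le (lam.strictMono h) le_rfl))

theorem supGap_trans_le (lam mu : TimeChange T) (x y z : SkorokhodSpace T) :
    supGap (lam.trans mu) x z ≤ supGap lam x y + supGap mu y z := by
  refine iSup_le fun t => ?_
  simp only [OrderIso.trans_apply]
  refine (ENNReal.ofReal_le_ofReal (abs_sub_le (x t) (y (lam t)) _)).trans
    (ENNReal.ofReal_add_le.trans (add_le_add ?_ ?_))
  · exact le_iSup_of_le t le_rfl
  · exact le_iSup_of_le (lam t) le_rfl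

theorem skDist_triangle (x y z : SkorokhodSpace T) :
    skDist x z ≤ skDist x y + skDist y z := by
  refine ENNReal.le_iInf_add_iInf fun lam mu => (iInf_le _ (lam.trans mu)).trans (max_le ?_ ?_)
  · exact (logNorm_trans_le lam mu).trans (add_le_add (le_max_left _ _) (le_max_left _ _))
  · exact (supGap_trans_le lam mu x y z).trans (add_le_add (le_max_right _ _) (le_max_right _ _))

/-- Paths are bounded. -/
theorem exists_bound (x : SkorokhodSpace T) : ∃ C : ℝ, ∀ t, |x t| ≤ C := by
  have key : ∃ C : ℝ, ∀ t ∈ (univ : Set (Icc (0 : ℝ) T)), |x t| ≤ C := by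
    refine isCompact_univ.induction_on (p := fun s => ∃ C : ℝ, ∀ t ∈ s, |x t| ≤ C)
      ⟨0, by simp⟩ (fun s t hst ⟨C, hC⟩ => ⟨C, fun u hu => hC u (hst hu)⟩) ?_ ?_
    · rintro s t ⟨C, hC⟩ ⟨C', hC'⟩
      refine ⟨max C C', fun u hu => hu.elim (fun h => (hC u h).trans (le_max_left _ _))
        (fun h => (hC' u h).trans (le_max_right _ _))⟩
    · intro t _
      obtain ⟨l, hl⟩ := x.left_lim t
      have h1 : ∀ᶠ u in 𝓝[<] t, |x u| ≤ |l| + 1 :=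
        (hl.abs.eventually (gt_mem_nhds (lt_add_one _))).mono fun _ h => le_of_lt h
      have h2 : ∀ᶠ u in 𝓝[>] t, |x u| ≤ |x t| + 1 :=
        ((x.right_cont t).abs.eventually (gt_mem_nhds (lt_add_one _))).mono fun _ h => le_of_lt h
      refine ⟨{u | |x u| ≤ max (|l| + 1) (|x t| + 1)}, ?_, _, fun u hu => hu⟩
      rw [nhdsWithin_univ, ← nhdsLT_sup_nhdsGE, ← Ioi_insert, nhdsWithin_insert]
      refine mem_sup.2 ⟨h1.mono fun u h => h.trans (le_max_left _ _), mem_sup.2 ⟨?_,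
        h2.mono fun u h => h.trans (le_max_right _ _)⟩⟩
      exact mem_pure.2 (le_trans (lt_add_one |x t|).le (le_max_right (|l| + 1) _))
  obtain ⟨C, hC⟩ := key
  exact ⟨C, fun t => hC t (mem_univ t)⟩

theorem skDist_ne_top (x y : SkorokhodSpace T) : skDist x y ≠ ∞ := by
  obtain ⟨C, hC⟩ := x.exists_bound
  obtain ⟨C', hC'⟩ := y.exists_bound
  refine ne_top_of_le_ne_top (ENNReal.ofReal_ne_top (r := C + C'))
    ((iInf_le _ (OrderIso.refl _)).trans ?_)
  rw [logNorm_refl]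
  refine max_le bot_le (iSup_le fun t => ENNReal.ofReal_le_ofReal ?_)
  exact (abs_sub _ _).trans (add_le_add (hC _) (hC' _))

theorem eq_of_skDist_eq_zero (x y : SkorokhodSpace T) (h : skDist x y = 0) : x = y := by
  have small : ∀ ε : ℝ, 0 < ε → ∃ lam : TimeChange T,
      (∀ s t, s < t → |Real.log (((lam t : ℝ) - lam s) / ((t : ℝ) - s))| ≤ ε) ∧
      ∀ t, |x t - y (lam t)| ≤ ε := by
    intro ε hε
    have hlt : skDist x y < ENNReal.ofReal ε := by rw [h]; simpa using hε
    obtain ⟨lam, hlam⟩ := iInf_lt_iff.1 hlt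
    refine ⟨lam, fun s t hst => ?_, fun t => ?_⟩
    · refine (ENNReal.ofReal_le_ofReal_iff hε.le).1 (le_trans ?_ ((le_max_left _ _).trans hlam.le))
      exact le_iSup_of_le s (le_iSup_of_le t (le_iSup_of_le hst le_rfl))
    · refine (ENNReal.ofReal_le_ofReal_iff hε.le).1 (le_trans ?_ ((le_max_right _ _).trans hlam.le))
      exact le_iSup_of_le t le_rfl
  ext t
  refine eq_of_abs_sub_nonpos (le_of_forall_pos_le_add fun ε hε => ?_)
  rw [zero_add]
  by_cases htop : (t : ℝ) = T
  · obtain ⟨lam, -, h2⟩ := small ε hε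
    have hmax : ∀ u : Icc (0 : ℝ) T, u ≤ t := fun u => by
      exact Subtype.coe_le_coe.1 (u.2.2.trans htop.ge)
    have : lam t = t := le_antisymm (hmax _) (by
      have := lam.monotone (hmax (lam.symm t)); rwa [OrderIso.apply_symm_apply] at this)
    simpa [this] using h2 t
  · have htT : (t : ℝ) < T := lt_of_le_of_ne t.2.2 htop
    have hT : (0 : ℝ) ≤ T := t.2.1.trans t.2.2
    have hε3 : 0 < ε / 3 := by positivity
    have hlt : t < (⟨T, hT, le_rfl⟩ : Icc (0 : ℝ) T) := htT
    obtain ⟨u, hu, hsub⟩ := (mem_nhdsGT_iff_exists_Ioo_subset' hlt).1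
      (inter_mem ((x.right_cont t).eventually (Metric.closedBall_mem_nhds (x t) hε3))
        ((y.right_cont t).eventually (Metric.closedBall_mem_nhds (y t) hε3)))
    obtain ⟨s, hts, hsu⟩ := exists_between (show t < u from hu)
    have hts' : (t : ℝ) < s := hts
    have hsu' : (s : ℝ) < u := hsu
    have hs0 : (0 : ℝ) < s := lt_of_le_of_lt t.2.1 hts'
    have c1 : Tendsto (fun η : ℝ => (s : ℝ) * Real.exp η) (𝓝 0) (𝓝 s) := by
      have : Continuous fun η : ℝ => (s : ℝ) * Real.exp η := by fun_prop
      simpa using this.tendsto 0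
    have c2 : Tendsto (fun η : ℝ => (s : ℝ) * Real.exp (-η)) (𝓝 0) (𝓝 s) := by
      have : Continuous fun η : ℝ => (s : ℝ) * Real.exp (-η) := by fun_prop
      simpa using this.tendsto 0
    have ev : ∀ᶠ η : ℝ in 𝓝[>] 0, (((s : ℝ) * Real.exp η < u ∧ (t : ℝ) < s * Real.exp (-η)) ∧
        η < ε / 3) ∧ 0 < η :=
      ((((c1.eventually (gt_mem_nhds hsu')).and (c2.eventually (lt_mem_nhds hts'))).and
        (gt_mem_nhds hε3)).filter_mono nhdsWithin_le_nhds).and self_mem_nhdsWithin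
    obtain ⟨η, ⟨⟨hη1, hη2⟩, hη3⟩, hη0⟩ := ev.exists
    obtain ⟨lam, g1, g2⟩ := small η hη0
    have hz : lam ⟨0, le_rfl, hT⟩ = ⟨0, le_rfl, hT⟩ := by
      have hmin : ∀ v : Icc (0 : ℝ) T, (⟨0, le_rfl, hT⟩ : Icc (0 : ℝ) T) ≤ v := fun v => v.2.1
      refine le_antisymm ?_ (hmin _)
      have := lam.monotone (hmin (lam.symm ⟨0, le_rfl, hT⟩))
      rwa [OrderIso.apply_symm_apply] at this
    have hz0 : (⟨0, le_rfl, hT⟩ : Icc (0 : ℝ) T) < s := hs0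
    have hl0 : (0 : ℝ) < lam s := by
      have := lam.strictMono hz0; rw [hz] at this; exact this
    have hlog := abs_le.1 (g1 _ s hz0)
    rw [hz] at hlog
    simp only [sub_zero] at hlog
    have hr : (0 : ℝ) < (lam s : ℝ) / s := by positivity
    have b1 : (lam s : ℝ) < u := by
      have := (Real.log_le_iff_le_exp hr).1 hlog.2
      rw [div_le_iff₀ hs0] at this
      linarith
    have b2 : (t : ℝ) < lam s := by
      have := (Real.le_log_iff_exp_le hr).1 hlog.1
      rw [le_div_iff₀ hs0] at this
      linarith
    have k1 := (hsub ⟨hts, hsu⟩).1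
    have k2 := (hsub (show lam s ∈ Ioo t u from ⟨b2, b1⟩)).2
    have k1' : |x s - x t| ≤ ε / 3 := k1
    have k2' : |y (lam s) - y t| ≤ ε / 3 := k2
    have k3 := g2 s
    rw [abs_le] at k1' k2' k3 ⊢
    constructor <;> linarith [k1'.1, k1'.2, k2'.1, k2'.2, k3.1, k3.2]

/-- `𝔻` with the metric `d°`: here `edist x y = skDist x y` definitionally, and
`dist x y = (skDist x y).toReal`. -/
instance : MetricSpace (SkorokhodSpace T) :=
  letI : EMetricSpace (SkorokhodSpace T) :=
    { edist := skDist
      edist_self := skDist_self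
      edist_comm := fun x y => le_antisymm (skDist_comm_le y x) (skDist_comm_le x y)
      edist_triangle := skDist_triangle
      eq_of_edist_eq_zero := fun {x y} h => eq_of_skDist_eq_zero x y h }
  EMetricSpace.toMetricSpace skDist_ne_top

theorem edist_eq_skDist (x y : SkorokhodSpace T) : edist x y = skDist x y := rfl

/-- The Borel σ-algebra of `(𝔻, d°)`. -/
instance : MeasurableSpace (SkorokhodSpace T) := borel _

instance : BorelSpace (SkorokhodSpace T) := ⟨rfl⟩

/-- `γ` is a probability measure on `𝔻 × 𝔻` with marginals `P` and `Q`. -/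
structure IsCoupling (γ : Measure (SkorokhodSpace T × SkorokhodSpace T))
    (P Q : Measure (SkorokhodSpace T)) : Prop where
  prob : IsProbabilityMeasure γ
  fst_eq : γ.fst = P
  snd_eq : γ.snd = Q

/-- The `p`-Wasserstein distance `D°_T(P,Q)` for the metric `d°`, with values in `[0,∞]`. -/
def wasserstein (p : ℝ) (P Q : Measure (SkorokhodSpace T)) : ℝ≥0∞ :=
  ⨅ (γ : Measure (SkorokhodSpace T × SkorokhodSpace T)) (_ : IsCoupling γ P Q),
    (∫⁻ z, edist z.1 z.2 ^ p ∂γ) ^ (1 / p)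

/-- `P` has finite `p`-th moment for `d°`: `∫ d°(x,0)^p P(dx) < ∞`. -/
def FiniteMoment (p : ℝ) (P : Measure (SkorokhodSpace T)) : Prop :=
  ∫⁻ x, edist x 0 ^ p ∂P < ∞

/-- The empirical measure `(1/n) ∑_{i<n} δ_{x i}`. -/
def empirical (x : ℕ → SkorokhodSpace T) (n : ℕ) : Measure (SkorokhodSpace T) :=
  (n : ℝ≥0∞)⁻¹ • ∑ i ∈ Finset.range n, Measure.dirac (x i)

end SkorokhodSpace

end

/-! Everything rests on separability of `(𝔻, d°)` (`secondCountableTopology`). It makes the Borel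
σ-algebra of a product the product of the Borel σ-algebras, so that `d°` is jointly measurable, and
it lets simple functions approximate the identity of `𝔻`.

Measurability: the distance from an empirical measure to `P` is a 1-Lipschitz function of its `n`
atoms (`wasserstein_empirical_le_add`).

Moment bound: the product coupling and the triangle inequality through `0` leave the `p`-th moments
of `L^n(ζ)` and of `P`, which agree in expectation (`lintegral_lintegral_empirical`).

Limit: a simple function `f` close to the identity in `p`-th mean for `P` is equally close in
expected `p`-th mean for `L^n(ζ)`. After rounding by `f`, mass that both measures share in a fibre
of `f` is coupled at no cost, and the remaining mass travels a bounded distance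
(`wasserstein_rpow_le_of_simpleFunc`). By the law of large numbers on the finitely many fibres, the
remaining mass tends to zero in mean. Neither tightness nor completeness of `𝔻` enters. -/

namespace SkorokhodSpace

variable {T : ℝ}

/-! ### Separability of the Skorokhod space -/

/-- Up to a finite set of break points, a path oscillates by at most `ε` on short intervals. -/
theorem exists_finite_local_oscillation (x : SkorokhodSpace T) {ε : ℝ} (hε : 0 < ε) :
    ∃ F : Set (Icc (0 : ℝ) T), F.Finite ∧ ∃ δ : ℝ, 0 < δ ∧ ∀ u v : Icc (0 : ℝ) T, u ≤ v → (v : ℝ) < u + δ →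
      (∀ c ∈ F, c ≤ v → c ≤ u) → |x u - x v| ≤ ε := by
  have key : ∃ F : Set (Icc (0 : ℝ) T), F.Finite ∧ ∃ δ : ℝ, 0 < δ ∧
      ∀ u ∈ (univ : Set (Icc (0 : ℝ) T)), ∀ v : Icc (0 : ℝ) T, u ≤ v → (v : ℝ) < u + δ →
      (∀ c ∈ F, c ≤ v → c ≤ u) → |x u - x v| ≤ ε := by
    refine isCompact_univ.induction_on (p := fun s => ∃ F : Set (Icc (0 : ℝ) T), F.Finite ∧
      ∃ δ : ℝ, 0 < δ ∧ ∀ u ∈ s, ∀ v : Icc (0 : ℝ) T, u ≤ v → (v : ℝ) < u + δ →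
      (∀ c ∈ F, c ≤ v → c ≤ u) → |x u - x v| ≤ ε) ⟨∅, finite_empty, 1, one_pos, by simp⟩ ?_ ?_ ?_
    · rintro s t hst ⟨F, hF, δ, hδ, h⟩
      exact ⟨F, hF, δ, hδ, fun u hu => h u (hst hu)⟩
    · rintro s t ⟨F, hF, δ, hδ, h⟩ ⟨F', hF', δ', hδ', h'⟩
      refine ⟨F ∪ F', hF.union hF', min δ δ', lt_min hδ hδ', fun u hu v huv hv hc => ?_⟩
      rcases hu with hu | hu
      · exact h u hu v huv (hv.trans_le (by gcongr; exact min_le_left _ _))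
          fun c hcF => hc c (Or.inl hcF)
      · exact h' u hu v huv (hv.trans_le (by gcongr; exact min_le_right _ _))
          fun c hcF => hc c (Or.inr hcF)
    -- Near `t` the path stays within `ε / 2` of its left limit on the left and of `x t` on the
    -- right. Only the jump at `t` can be large, so `t` is the one break point needed here.
    · intro t _
      obtain ⟨l, hl⟩ := x.left_lim t
      have hε2 : 0 < ε / 2 := by positivity
      have h1 := Metric.mem_nhdsWithin_iff.1 (hl (Metric.closedBall_mem_nhds l hε2))
      have h2 := Metric.mem_nhdsWithin_iff.1
        (x.right_cont t (Metric.closedBall_mem_nhds (x t) hε2))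
      obtain ⟨r₁, hr₁, hb₁⟩ := h1
      obtain ⟨r₂, hr₂, hb₂⟩ := h2
      have hleft : ∀ u : Icc (0 : ℝ) T, u < t → dist u t < r₁ → |x u - l| ≤ ε / 2 :=
        fun u hu hd => hb₁ ⟨hd, hu⟩
      have hright : ∀ u : Icc (0 : ℝ) T, t ≤ u → dist u t < r₂ → |x u - x t| ≤ ε / 2 := by
        intro u hu hd
        rcases hu.eq_or_lt with rfl | hu
        · simpa using hε2.le
        · exact hb₂ ⟨hd, hu⟩
      -- Half the radius bounds the distance from `u` to `t`, the other half the step from `u` to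
      -- `v`.
      have hr : 0 < min r₁ r₂ / 2 := by have := lt_min hr₁ hr₂; linarith
      refine ⟨Metric.ball t (min r₁ r₂ / 2), ?_, {t}, finite_singleton t, min r₁ r₂ / 2, hr, ?_⟩
      · rw [nhdsWithin_univ]; exact Metric.ball_mem_nhds t hr
      · intro u hu v huv hv hc
        have hut : |(u : ℝ) - t| < min r₁ r₂ / 2 := hu
        have huv' : (u : ℝ) ≤ v := huv
        have hd : ∀ w : Icc (0 : ℝ) T, u ≤ w → w ≤ v → dist w t < min r₁ r₂ := by
          intro w huw hwv
          have huw' : (u : ℝ) ≤ w := huw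
          have hwv' : (w : ℝ) ≤ v := hwv
          change |(w : ℝ) - t| < _
          rw [abs_lt] at hut ⊢
          constructor <;> linarith
        have du := hd u le_rfl huv
        have dv := hd v huv le_rfl
        rcases le_or_gt t v with htv | htv
        · have htu := hc t rfl htv
          have a := abs_le.1 (hright u htu (du.trans_le (min_le_right _ _)))
          have b := abs_le.1 (hright v htv (dv.trans_le (min_le_right _ _)))
          rw [abs_le]; constructor <;> linarith
        · have a := abs_le.1 (hleft u (huv.trans_lt htv) (du.trans_le (min_le_left _ _)))
          have b := abs_le.1 (hleft v htv (dv.trans_le (min_le_left _ _)))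
          rw [abs_le]; constructor <;> linarith
  obtain ⟨F, hF, δ, hδ, h⟩ := key
  exact ⟨F, hF, δ, hδ, fun u => h u (mem_univ u)⟩

/-- A path oscillates by at most `ε` between consecutive points of a suitable finite set. -/
theorem exists_finset_oscillation (x : SkorokhodSpace T) {ε : ℝ} (hε : 0 < ε)
    (S : Finset (Icc (0 : ℝ) T)) :
    ∃ F : Finset (Icc (0 : ℝ) T), S ⊆ F ∧ ∀ u v, u ≤ v →
      (∀ c ∈ F, c ≤ v → c ≤ u) → |x u - x v| ≤ ε := by
  classical
  obtain ⟨F, hF, δ, hδ, h⟩ := x.exists_finite_local_oscillation hε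
  obtain ⟨N, -, hN, hcov⟩ := (isCompact_univ (X := Icc (0 : ℝ) T)).finite_cover_balls
    (e := δ / 2) (by positivity)
  -- The `δ / 2`-net `N` replaces the condition `v < u + δ`: if `v - u ≥ δ`, the net point near the
  -- midpoint of `u` and `v` lies in `(u, v]`, which the hypothesis on `u` and `v` excludes.
  refine ⟨S ∪ (hF.toFinset ∪ hN.toFinset), Finset.subset_union_left, fun u v huv hc => ?_⟩
  refine h u v huv ?_ fun c hcF => hc c (by simp [hcF])
  by_contra! hlt
  let w : Icc (0 : ℝ) T := ⟨(u + v) / 2, by linarith [u.2.1, v.2.1], by linarith [u.2.2, v.2.2]⟩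
  obtain ⟨c, hcN, hwc⟩ := mem_iUnion₂.1 (hcov (mem_univ w))
  have hwc' : |((u : ℝ) + v) / 2 - c| < δ / 2 := hwc
  rw [abs_lt] at hwc'
  have := hc c (by simp [hcN]) (show (c : ℝ) ≤ v by linarith)
  have : (c : ℝ) ≤ u := this
  linarith

/-- A `δ`-Lipschitz perturbation of the identity that fixes the end points is a time change of
small logarithmic norm. -/
theorem exists_timeChange (hT : 0 < T) {δ : ℝ} (hδ0 : 0 ≤ δ) (hδ : δ ≤ 1 / 2) {φ : ℝ → ℝ}
    (hφ : ∀ s t, |φ s - φ t| ≤ δ * |s - t|) (h0 : φ 0 = 0) (h1 : φ T = 0) :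
    ∃ lam : TimeChange T, (∀ t, (lam t : ℝ) = t + φ t) ∧
      logNorm lam ≤ ENNReal.ofReal (2 * δ) := by
  have hinc : ∀ s t : ℝ, s < t → (1 - δ) * (t - s) ≤ (t + φ t) - (s + φ s) ∧
      (t + φ t) - (s + φ s) ≤ (1 + δ) * (t - s) := by
    intro s t hst
    have := hφ t s
    rw [abs_of_pos (sub_pos.2 hst), abs_le] at this
    constructor <;> linarith
  have hmono : StrictMono fun t : ℝ => t + φ t := by
    intro s t hst
    have := (hinc s t hst).1
    have : 0 < (1 - δ) * (t - s) := mul_pos (by linarith) (by linarith)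
    simp only
    linarith
  have hcont : Continuous fun t : ℝ => t + φ t := by
    refine continuous_id.add (LipschitzWith.continuous (K := ⟨δ, hδ0⟩)
      (LipschitzWith.of_dist_le_mul fun s t => ?_))
    exact hφ s t
  have hmem : ∀ t : Icc (0 : ℝ) T, (t : ℝ) + φ t ∈ Icc (0 : ℝ) T := by
    intro t
    have a := hmono.monotone t.2.1
    have b := hmono.monotone t.2.2
    simp only [h0, h1] at a b
    exact ⟨by linarith, by linarith⟩
  let f : Icc (0 : ℝ) T → Icc (0 : ℝ) T := fun t => ⟨t + φ t, hmem t⟩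
  have hf : StrictMono f := fun s t hst => hmono hst
  have hsurj : Function.Surjective f := by
    intro y
    have := intermediate_value_Icc hT.le hcont.continuousOn
    simp only [h0, h1, add_zero] at this
    obtain ⟨t, ht, hty⟩ := this y.2
    exact ⟨⟨t, ht⟩, Subtype.ext hty⟩
  refine ⟨hf.orderIsoOfSurjective f hsurj, fun t => rfl, ?_⟩
  refine iSup_le fun s => iSup_le fun t => iSup_le fun hst => ENNReal.ofReal_le_ofReal ?_
  have hst' : (s : ℝ) < t := hst
  have hpos : 0 < (t : ℝ) - s := sub_pos.2 hst'
  obtain ⟨a, b⟩ := hinc s t hst'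
  change |Real.log (((t + φ t) - (s + φ s)) / ((t : ℝ) - s))| ≤ _
  set r := ((t + φ t) - (s + φ s)) / ((t : ℝ) - s) with hr
  have ra : 1 - δ ≤ r := (le_div_iff₀ hpos).2 a
  have rb : r ≤ 1 + δ := (div_le_iff₀ hpos).2 b
  have r0 : 0 < r := by linarith
  have l1 := Real.log_le_sub_one_of_pos r0
  have l2 := Real.one_sub_inv_le_log_of_pos r0
  -- For `δ ≤ 1 / 2` one has `1 / (1 - δ) ≤ 1 + 2 * δ`; this is the source of the factor `2`.
  have l3 : r⁻¹ ≤ 1 + 2 * δ := by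
    rw [inv_le_iff_one_le_mul₀ r0]
    nlinarith
  rw [abs_le]
  constructor <;> linarith

/-- The interpolation of finitely many small displacements by a time change. -/
theorem exists_timeChange_interpolating (hT : 0 < T) {δ : ℝ} (hδ0 : 0 ≤ δ) (hδ : δ ≤ 1 / 2)
    {ι : Type*} {m : ℝ} (s t : ι → Icc (0 : ℝ) T)
    (hs : Function.Injective s)
    (hgap : ∀ i j, i ≠ j → m ≤ |(s i : ℝ) - s j|)
    (hst : ∀ i, |(t i : ℝ) - s i| ≤ δ / 2 * m)
    {a b : ι} (ha : (s a : ℝ) = 0) (ha' : (t a : ℝ) = 0) (hb : (s b : ℝ) = T)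
    (hb' : (t b : ℝ) = T) :
    ∃ lam : TimeChange T, (∀ i, lam (s i) = t i) ∧ logNorm lam ≤ ENNReal.ofReal (2 * δ) := by
  have hinj : Function.Injective fun i => (s i : ℝ) := Subtype.val_injective.comp hs
  -- The displacements `t i - s i` form a `δ`-Lipschitz function on the points `s i`: two of them
  -- differ by at most `δ * m`, and distinct points are at least `m` apart. It extends to the line
  -- with the same constant.
  obtain ⟨φ, hφ, hφs⟩ := LipschitzOnWith.extend_real
    (f := fun u => Function.extend (fun i => (s i : ℝ)) (fun i => (t i : ℝ) - s i) 0 u)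
    (s := range fun i => (s i : ℝ)) (K := ⟨δ, hδ0⟩) (by
      refine LipschitzOnWith.of_dist_le_mul ?_
      rintro _ ⟨i, rfl⟩ _ ⟨j, rfl⟩
      simp only [hinj.extend_apply]
      rcases eq_or_ne i j with rfl | hij
      · simp
      have h1 := abs_le.1 (hst i)
      have h2 := abs_le.1 (hst j)
      have h3 : δ * m ≤ δ * |(s i : ℝ) - s j| := mul_le_mul_of_nonneg_left (hgap i j hij) hδ0
      change |_| ≤ δ * |_|
      refine le_trans ?_ h3
      rw [abs_le]; constructor <;> linarith)
  have hval : ∀ i, φ (s i) = t i - s i := fun i => by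
    exact (hφs (mem_range_self i)).symm.trans (hinj.extend_apply _ _ i)
  obtain ⟨lam, h1, h2⟩ := exists_timeChange hT hδ0 hδ (φ := φ)
    (fun u v => hφ.dist_le_mul u v) (by have := hval a; rw [ha, ha'] at this; simpa using this)
    (by have := hval b; rw [hb, hb'] at this; simpa using this)
  exact ⟨lam, fun i => Subtype.ext (by rw [h1, hval]; ring), h2⟩

/-- Since `lam` preserves order, it carries the last `s i` before `u` to the last `t i` before `lam
u`. Passing from `x u` to `y (lam u)` through `x (s i)` and `y (t i)` costs `ε` three times. -/
theorem supGap_le_of_partition {ι : Type*} [Finite ι] {ε : ℝ} {x y : SkorokhodSpace T}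
    {s t : ι → Icc (0 : ℝ) T} {lam : TimeChange T} (hlam : ∀ i, lam (s i) = t i)
    {a : ι} (ha : (s a : ℝ) = 0)
    (hx : ∀ u v, u ≤ v → (∀ i, s i ≤ v → s i ≤ u) → |x u - x v| ≤ ε)
    (hy : ∀ u v, u ≤ v → (∀ i, t i ≤ v → t i ≤ u) → |y u - y v| ≤ ε)
    (hxy : ∀ i, |x (s i) - y (t i)| ≤ ε) :
    supGap lam x y ≤ ENNReal.ofReal (3 * ε) := by
  refine iSup_le fun u => ENNReal.ofReal_le_ofReal ?_
  obtain ⟨i, hi, hmax⟩ := (toFinite {i | s i ≤ u}).exists_maximalFor s _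
    ⟨a, show (s a : ℝ) ≤ u by rw [ha]; exact u.2.1⟩
  have hle : ∀ j, s j ≤ u → s j ≤ s i := fun j hj => by
    rcases le_total (s j) (s i) with h | h
    · exact h
    · exact hmax hj h
  have h1 := abs_le.1 (hx (s i) u hi hle)
  have h2 := abs_le.1 (hy (t i) (lam u) (by rw [← hlam]; exact lam.monotone hi) fun j hj => by
    rw [← hlam] at hj ⊢
    rw [← hlam]
    exact lam.monotone (hle j (lam.le_iff_le.1 hj)))
  have h3 := abs_le.1 (hxy i)
  rw [abs_le]
  constructor <;> linarith

/-- `(𝔻, d°)` is separable. -/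
theorem secondCountableTopology (hT : 0 < T) : SecondCountableTopology (SkorokhodSpace T) := by
  refine Metric.secondCountable_of_countable_discretization fun ε₀ hε₀ => ?_
  -- The bound `ε₀ / 3` absorbs the `3 * ε` of `supGap_le_of_partition`, and `1 / 2` is the largest
  -- slope perturbation allowed in `exists_timeChange_interpolating`.
  let ε : ℝ := min (ε₀ / 3) (1 / 2)
  have hε : 0 < ε := by positivity
  let z : Icc (0 : ℝ) T := ⟨0, le_rfl, hT.le⟩
  let e : Icc (0 : ℝ) T := ⟨T, hT.le, le_rfl⟩
  -- A code records the number of partition points, the indices of `0` and `T`, rational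
  -- approximations of the points, rounded values of the path there, and a rational bound for the
  -- gaps. There are countably many codes. The tolerance `ε / 4` puts partitions with the same code
  -- within `ε / 2` times the gap bound, as the interpolation requires.
  let R (x : SkorokhodSpace T)
      (c : Σ N : ℕ, Fin N × Fin N × (Fin N → ℚ) × (Fin N → ℤ) × ℚ) : Prop :=
    ∃ s : Fin c.1 → Icc (0 : ℝ) T, Function.Injective s ∧ s c.2.1 = z ∧ s c.2.2.1 = e ∧
      (∀ i j, i ≠ j → (c.2.2.2.2.2 : ℝ) ≤ |(s i : ℝ) - s j|) ∧
      (∀ i, |(s i : ℝ) - c.2.2.2.1 i| ≤ ε / 4 * c.2.2.2.2.2) ∧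
      (∀ i, ⌊x (s i) / ε⌋ = c.2.2.2.2.1 i) ∧
      ∀ u v, u ≤ v → (∀ i, s i ≤ v → s i ≤ u) → |x u - x v| ≤ ε
  have hR : ∀ x, ∃ c, R x c := by
    intro x
    classical
    obtain ⟨F, hF, hosc⟩ := x.exists_finset_oscillation hε {z, e}
    let s : Fin F.card → Icc (0 : ℝ) T := fun i => (F.equivFin.symm i : Icc (0 : ℝ) T)
    have hs : Function.Injective s := Subtype.val_injective.comp F.equivFin.symm.injective
    have hsurj : ∀ c ∈ F, ∃ i, s i = c := fun c hc =>
      ⟨F.equivFin ⟨c, hc⟩, by simp [s]⟩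
    obtain ⟨a, ha⟩ := hsurj z (hF (by simp))
    obtain ⟨b, hb⟩ := hsurj e (hF (by simp))
    obtain ⟨m, hm0, hm⟩ : ∃ m : ℚ, 0 < m ∧ ∀ i j, i ≠ j → (m : ℝ) ≤ |(s i : ℝ) - s j| := by
      have hev : ∀ᶠ r : ℝ in 𝓝[>] 0, ∀ i j, i ≠ j → r ≤ |(s i : ℝ) - s j| := by
        rw [eventually_all]; intro i
        rw [eventually_all]; intro j
        rw [eventually_all]; intro hij
        have : 0 < |(s i : ℝ) - s j| :=
          abs_pos.2 (sub_ne_zero.2 fun h => hij (hs (Subtype.ext h)))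
        exact (eventually_le_nhds this).filter_mono nhdsWithin_le_nhds
      obtain ⟨r, hr, hr0⟩ := (hev.and self_mem_nhdsWithin).exists
      obtain ⟨m, hm0, hmr⟩ := exists_rat_btwn (show (0 : ℝ) < r from hr0)
      exact ⟨m, by exact_mod_cast hm0, fun i j hij => hmr.le.trans (hr i j hij)⟩
    have hpos : 0 < ε / 4 * (m : ℝ) := by
      have : (0 : ℝ) < m := by exact_mod_cast hm0
      positivity
    choose q hq using fun i => exists_rat_near (s i : ℝ) hpos
    refine ⟨⟨F.card, a, b, q, fun i => ⌊x (s i) / ε⌋, m⟩, s, hs, ha, hb, hm,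
      fun i => (hq i).le, fun i => rfl, fun u v huv h => hosc u v huv fun c hc hcv => ?_⟩
    obtain ⟨i, rfl⟩ := hsurj c hc
    exact h i hcv
  choose code hcode using hR
  refine ⟨_, Encodable.ofCountable _, code, fun x y hxy => ?_⟩
  obtain ⟨s, hs, hsa, hsb, hsm, hsq, hsx, hsosc⟩ := hcode x
  have hy := hcode y
  rw [← hxy] at hy
  obtain ⟨t, -, hta, htb, -, htq, hty, htosc⟩ := hy
  have hst : ∀ i, |(t i : ℝ) - s i| ≤ ε / 2 * (code x).2.2.2.2.2 := fun i => by
    have h1 := abs_le.1 (hsq i)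
    have h2 := abs_le.1 (htq i)
    rw [abs_le]; constructor <;> linarith
  obtain ⟨lam, h1, h2⟩ := exists_timeChange_interpolating hT hε.le (min_le_right _ _) s t hs hsm
    hst (congrArg Subtype.val hsa) (congrArg Subtype.val hta) (congrArg Subtype.val hsb)
    (congrArg Subtype.val htb)
  have h3 := supGap_le_of_partition h1 (congrArg Subtype.val hsa) hsosc htosc fun i => by
    have := Int.abs_sub_lt_one_of_floor_eq_floor ((hsx i).trans (hty i).symm)
    rw [← sub_div, abs_div, abs_of_pos hε, div_lt_one hε] at this
    exact this.le
  have hle : 3 * ε ≤ ε₀ := by linarith [min_le_left (ε₀ / 3) (1 / 2)]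
  rw [dist_edist, edist_eq_skDist]
  refine ENNReal.toReal_le_of_le_ofReal hε₀.le ((iInf_le _ lam).trans (max_le ?_ ?_))
  · exact h2.trans (ENNReal.ofReal_le_ofReal (by linarith))
  · exact h3.trans (ENNReal.ofReal_le_ofReal hle)

/-! ### Empirical measures and measurability -/

theorem lintegral_empirical (x : ℕ → SkorokhodSpace T) (n : ℕ) {g : SkorokhodSpace T → ℝ≥0∞}
    (hg : Measurable g) :
    ∫⁻ y, g y ∂empirical x n = (n : ℝ≥0∞)⁻¹ * ∑ i ∈ Finset.range n, g (x i) := by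
  simp only [empirical, lintegral_smul_measure, lintegral_finsetSum_measure, smul_eq_mul,
    lintegral_dirac' _ hg]

theorem empirical_apply (x : ℕ → SkorokhodSpace T) (n : ℕ) {A : Set (SkorokhodSpace T)}
    (hA : MeasurableSet A) :
    empirical x n A = (n : ℝ≥0∞)⁻¹ * ∑ i ∈ Finset.range n, A.indicator 1 (x i) := by
  rw [← lintegral_empirical x n (measurable_one.indicator hA), lintegral_indicator_one hA]

theorem isProbabilityMeasure_empirical (x : ℕ → SkorokhodSpace T) {n : ℕ} (hn : 1 ≤ n) :
    IsProbabilityMeasure (empirical x n) := by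
  constructor
  rw [empirical_apply x n MeasurableSet.univ]
  simp only [indicator_univ, Pi.one_apply, Finset.sum_const, Finset.card_range, nsmul_eq_mul,
    mul_one]
  exact ENNReal.inv_mul_cancel (by positivity) (ENNReal.natCast_ne_top n)

theorem empirical_congr {x y : ℕ → SkorokhodSpace T} {n : ℕ} (h : ∀ i < n, x i = y i) :
    empirical x n = empirical y n := by
  rw [empirical, empirical, Finset.sum_congr rfl fun i hi => by rw [h i (Finset.mem_range.1 hi)]]

theorem measure_fst_preimage_eq {γ : Measure (SkorokhodSpace T × SkorokhodSpace T)}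
    {P Q : Measure (SkorokhodSpace T)} (hγ : IsCoupling γ P Q) {A : Set (SkorokhodSpace T)}
    (hA : MeasurableSet A) : γ (Prod.fst ⁻¹' A) = P A := by
  rw [← hγ.fst_eq, Measure.fst_apply hA]

/-- A coupling of an empirical measure splits into its parts over the single atoms. -/
theorem sum_restrict_atom {x : ℕ → SkorokhodSpace T} {n : ℕ} {P : Measure (SkorokhodSpace T)}
    {γ : Measure (SkorokhodSpace T × SkorokhodSpace T)} (hγ : IsCoupling γ (empirical x n) P) :
    ∑ i ∈ Finset.range n, ((n : ℝ≥0∞)⁻¹ * (empirical x n {x i})⁻¹) •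
      γ.restrict (Prod.fst ⁻¹' {x i}) = γ := by
  classical
  have := hγ.prob
  -- `h z.1` is the density of the sum with respect to `γ`. An atom listed `k` times has weight `1 /
  -- k` for each listing, so `h = 1` on the atoms, whose fibres carry all of `γ`.
  let h : SkorokhodSpace T → ℝ≥0∞ := fun a => ∑ i ∈ Finset.range n,
    ((n : ℝ≥0∞)⁻¹ * (empirical x n {x i})⁻¹) * ({x i} : Set (SkorokhodSpace T)).indicator 1 a
  have hatom : ∀ k < n, h (x k) = 1 := by
    intro k hk
    have e : ∀ i, ((n : ℝ≥0∞)⁻¹ * (empirical x n {x i})⁻¹) *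
        ({x i} : Set (SkorokhodSpace T)).indicator 1 (x k) =
        (empirical x n {x k})⁻¹ * ((n : ℝ≥0∞)⁻¹ *
          ({x k} : Set (SkorokhodSpace T)).indicator 1 (x i)) := by
      intro i
      by_cases hik : x i = x k
      · simp [hik, mul_comm]
      · simp [hik, Ne.symm hik]
    simp only [h, e]
    rw [← Finset.mul_sum, ← Finset.mul_sum, ← empirical_apply x n (measurableSet_singleton _)]
    refine ENNReal.inv_mul_cancel ?_ ?_
    · rw [empirical_apply x n (measurableSet_singleton _)]
      refine mul_ne_zero (by simp) fun h0 => ?_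
      have := Finset.sum_eq_zero_iff.1 h0 k (Finset.mem_range.2 hk)
      simp at this
    · have := isProbabilityMeasure_empirical x (show 1 ≤ n by omega)
      exact measure_ne_top _ _
  have hset : MeasurableSet (x '' Iio n) := ((finite_Iio n).image x).measurableSet
  have hae : ∀ᵐ z ∂γ, h z.1 = 1 := by
    have h0 : γ (Prod.fst ⁻¹' (x '' Iio n)ᶜ) = 0 := by
      rw [measure_fst_preimage_eq hγ hset.compl, empirical_apply x n hset.compl,
        Finset.sum_eq_zero, mul_zero]
      intro i hi
      have hmem : x i ∉ (x '' Iio n)ᶜ := fun hc => hc ⟨i, Finset.mem_range.1 hi, rfl⟩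
      exact indicator_of_notMem hmem _
    refine measure_mono_null (fun z hz => ?_) h0
    rintro ⟨k, hk, hkz⟩
    exact hz (show h z.1 = 1 from hkz ▸ hatom k hk)
  ext B hB
  have hm : ∀ i, MeasurableSet (Prod.fst ⁻¹' {x i} : Set (SkorokhodSpace T × SkorokhodSpace T)) :=
    fun i => measurable_fst (measurableSet_singleton _)
  calc _ = ∑ i ∈ Finset.range n, ((n : ℝ≥0∞)⁻¹ * (empirical x n {x i})⁻¹) *
        ∫⁻ z in B, (Prod.fst ⁻¹' {x i} :
          Set (SkorokhodSpace T × SkorokhodSpace T)).indicator 1 z ∂γ := by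
        simp only [Measure.finsetSum_apply, Measure.smul_apply, smul_eq_mul]
        refine Finset.sum_congr rfl fun i _ => ?_
        rw [lintegral_indicator_one (hm i), Measure.restrict_apply hB,
          Measure.restrict_apply (hm i), inter_comm]
    _ = ∫⁻ z in B, h z.1 ∂γ := by
        simp only [h]
        rw [lintegral_finsetSum]
        · refine Finset.sum_congr rfl fun i _ => ?_
          rw [← lintegral_const_mul _ (measurable_one.indicator (hm i))]
          rfl
        · intro i _
          exact ((measurable_one.indicator (measurableSet_singleton (x i))).comp
            measurable_fst).const_mul _
    _ = γ B := by
        rw [lintegral_congr_ae (ae_restrict_of_ae hae)]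
        simp

section SecondCountable

variable [SecondCountableTopology (SkorokhodSpace T)]

/-- Moving every atom of an empirical measure by at most `η` changes the Wasserstein distance to a
fixed measure by at most `η`. -/
theorem wasserstein_empirical_le_add {p : ℝ} (hp : 1 ≤ p) {x y : ℕ → SkorokhodSpace T} {n : ℕ}
    {P : Measure (SkorokhodSpace T)} {η : ℝ≥0∞} (hη : ∀ i < n, edist (y i) (x i) ≤ η) :
    wasserstein p (empirical y n) P ≤ wasserstein p (empirical x n) P + η := by
  have hp0 : 0 < p := by linarith
  rw [wasserstein, wasserstein, ENNReal.iInf_add]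
  refine le_iInf fun γ => ?_
  rw [ENNReal.iInf_add]
  refine le_iInf fun hγ => ?_
  have := hγ.prob
  have hsplit := sum_restrict_atom hγ
  set c : ℕ → ℝ≥0∞ := fun i => (n : ℝ≥0∞)⁻¹ * (empirical x n {x i})⁻¹ with hc
  have hφ : ∀ i, Measurable fun z : SkorokhodSpace T × SkorokhodSpace T => (y i, z.2) :=
    fun i => measurable_const.prodMk measurable_snd
  -- The piece of index `i` has its first coordinate moved to `y i` and keeps its second. The pieces
  -- are indexed by `i`, not by atom, because equal `x i` may move to different `y i`.
  let γ' : Measure (SkorokhodSpace T × SkorokhodSpace T) := ∑ i ∈ Finset.range n,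
    c i • (γ.restrict (Prod.fst ⁻¹' {x i})).map fun z => (y i, z.2)
  have hmass : ∀ i < n, c i * γ (Prod.fst ⁻¹' {x i}) = (n : ℝ≥0∞)⁻¹ := by
    intro i hi
    have := isProbabilityMeasure_empirical x (show 1 ≤ n by omega)
    rw [measure_fst_preimage_eq hγ (measurableSet_singleton _), hc]
    simp only
    rw [mul_assoc, ENNReal.inv_mul_cancel, mul_one]
    · rw [empirical_apply x n (measurableSet_singleton _)]
      refine mul_ne_zero (by simp) fun h0 => ?_
      have := Finset.sum_eq_zero_iff.1 h0 i (Finset.mem_range.2 hi)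
      simp at this
    · exact measure_ne_top _ _
  have hfst : γ'.fst = empirical y n := by
    ext A hA
    rw [Measure.fst_apply hA, empirical_apply y n hA, Finset.mul_sum]
    simp only [γ', Measure.finsetSum_apply, Measure.smul_apply, smul_eq_mul]
    refine Finset.sum_congr rfl fun i hi => ?_
    rw [Measure.map_apply (hφ i) (measurable_fst hA)]
    by_cases hy : y i ∈ A
    · have : (fun z : SkorokhodSpace T × SkorokhodSpace T => (y i, z.2)) ⁻¹' (Prod.fst ⁻¹' A)
          = univ := by ext z; simp [hy]
      rw [this, Measure.restrict_apply_univ, hmass i (Finset.mem_range.1 hi)]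
      simp [hy]
    · have : (fun z : SkorokhodSpace T × SkorokhodSpace T => (y i, z.2)) ⁻¹' (Prod.fst ⁻¹' A)
          = ∅ := by ext z; simp [hy]
      rw [this]
      simp [hy]
  have hsnd : γ'.snd = P := by
    ext A hA
    rw [← hγ.snd_eq, Measure.snd_apply hA, Measure.snd_apply hA]
    conv_rhs => rw [← hsplit]
    simp only [γ', Measure.finsetSum_apply, Measure.smul_apply, smul_eq_mul]
    refine Finset.sum_congr rfl fun i hi => ?_
    rw [Measure.map_apply (hφ i) (measurable_snd hA)]
    rfl
  have hprob : IsProbabilityMeasure γ' := by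
    constructor
    rw [← Measure.snd_univ, hsnd, ← hγ.snd_eq, Measure.snd_univ, measure_univ]
  have hm : Measurable fun z : SkorokhodSpace T × SkorokhodSpace T => edist z.1 z.2 :=
    measurable_edist
  refine (iInf₂_le γ' ⟨hprob, hfst, hsnd⟩).trans ?_
  have hcost : ∫⁻ z, edist z.1 z.2 ^ p ∂γ' ≤
      ∫⁻ z, (edist z.1 z.2 + η) ^ p ∂γ := by
    conv_rhs => rw [← hsplit]
    simp only [γ', lintegral_finsetSum_measure, lintegral_smul_measure, smul_eq_mul]
    refine Finset.sum_le_sum fun i hi => mul_le_mul_right ?_ _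
    rw [lintegral_map (hm.pow_const p) (hφ i)]
    refine setLIntegral_mono' (measurable_fst (measurableSet_singleton _)) fun z hz => ?_
    have hz' : z.1 = x i := hz
    refine ENNReal.rpow_le_rpow ?_ hp0.le
    rw [hz', add_comm]
    exact (edist_triangle _ (x i) _).trans
      (add_le_add (hη i (Finset.mem_range.1 hi)) le_rfl)
  refine (ENNReal.rpow_le_rpow hcost (by positivity)).trans
    ((ENNReal.lintegral_Lp_add_le hm.aemeasurable aemeasurable_const hp).trans ?_)
  gcongr
  rw [lintegral_const, measure_univ, mul_one, ← ENNReal.rpow_mul, mul_one_div_cancel hp0.ne',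
    ENNReal.rpow_one]

/-- The Wasserstein distance of the empirical measure of random paths to a fixed measure is a
random variable. -/
theorem measurable_wasserstein_empirical {p : ℝ} (hp : 1 ≤ p) {Ω : Type*} [MeasurableSpace Ω]
    (P : Measure (SkorokhodSpace T)) {ζ : ℕ → Ω → SkorokhodSpace T}
    (hζ : ∀ i, Measurable (ζ i)) (n : ℕ) :
    Measurable fun ω => wasserstein p (empirical (fun i => ζ i ω) n) P := by
  let extend : (Fin n → SkorokhodSpace T) → ℕ → SkorokhodSpace T :=
    fun x i => if h : i < n then x ⟨i, h⟩ else 0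
  -- Only indices below `n` enter the empirical measure, so the padding by `0` is harmless. The map
  -- is 1-Lipschitz for the sup distance on `n`-tuples.
  have hcont : Continuous fun x => wasserstein p (empirical (extend x) n) P := by
    refine continuous_of_le_add_edist 1 ENNReal.one_ne_top fun x y => ?_
    rw [one_mul]
    refine wasserstein_empirical_le_add hp fun i hi => ?_
    simp only [extend, hi, dif_pos]
    exact edist_le_pi_edist x y _
  have hmeas : Measurable fun ω => fun i : Fin n => ζ i ω := measurable_pi_lambda _ fun i => hζ i
  convert hcont.measurable.comp hmeas using 1
  ext ω
  exact congrArg (wasserstein p · P) (empirical_congr fun i hi => by simp [extend, hi])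

end SecondCountable

/-! ### The moment bound -/

theorem wasserstein_rpow_le {p : ℝ} (hp : 0 < p) {P Q : Measure (SkorokhodSpace T)}
    {γ : Measure (SkorokhodSpace T × SkorokhodSpace T)} (hγ : IsCoupling γ P Q) :
    wasserstein p P Q ^ p ≤ ∫⁻ z, edist z.1 z.2 ^ p ∂γ := by
  refine (ENNReal.rpow_le_rpow (iInf₂_le γ hγ) hp.le).trans (le_of_eq ?_)
  rw [← ENNReal.rpow_mul, one_div_mul_cancel hp.ne', ENNReal.rpow_one]

theorem isCoupling_prod (P Q : Measure (SkorokhodSpace T)) [IsProbabilityMeasure P]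
    [IsProbabilityMeasure Q] : IsCoupling (P.prod Q) P Q :=
  ⟨inferInstance, Measure.fst_prod, Measure.snd_prod⟩

/-- Under any coupling with a Dirac mass the second coordinate is almost surely `a`, so every
coupling has the same cost. -/
theorem lintegral_le_wasserstein_dirac {p : ℝ} (hp : 0 < p) (P : Measure (SkorokhodSpace T))
    (a : SkorokhodSpace T) :
    ∫⁻ x, edist x a ^ p ∂P ≤ wasserstein p P (Measure.dirac a) ^ p := by
  have hm : Measurable fun x : SkorokhodSpace T => edist x a ^ p :=
    (continuous_id.edist continuous_const).measurable.pow_const p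
  rw [← ENNReal.rpow_one (∫⁻ x, edist x a ^ p ∂P), ← one_div_mul_cancel hp.ne', ENNReal.rpow_mul]
  refine ENNReal.rpow_le_rpow (le_iInf₂ fun γ hγ => ENNReal.rpow_le_rpow (le_of_eq ?_) ?_) hp.le
  · have hae : ∀ᵐ z ∂γ, z.2 = a := by
      have : ∀ᵐ x ∂γ.snd, x = a := by
        rw [hγ.snd_eq]
        exact (ae_dirac_iff (measurableSet_singleton a)).2 rfl
      exact ae_of_ae_map measurable_snd.aemeasurable this
    rw [← hγ.fst_eq, Measure.fst, lintegral_map hm measurable_fst]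
    refine lintegral_congr_ae (hae.mono fun z hz => ?_)
    simp only [hz]
  · positivity

theorem lintegral_lintegral_empirical {Ω : Type*} [MeasurableSpace Ω] {μ : Measure Ω}
    {P : Measure (SkorokhodSpace T)} {ζ : ℕ → Ω → SkorokhodSpace T}
    (hζ : ∀ i, Measurable (ζ i)) (hlaw : ∀ i, μ.map (ζ i) = P) {n : ℕ} (hn : 1 ≤ n)
    {g : SkorokhodSpace T → ℝ≥0∞} (hg : Measurable g) :
    ∫⁻ ω, ∫⁻ x, g x ∂empirical (fun i => ζ i ω) n ∂μ = ∫⁻ x, g x ∂P := by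
  simp only [lintegral_empirical _ _ hg]
  have hgζ : ∀ i, Measurable fun ω => g (ζ i ω) := fun i => hg.comp (hζ i)
  rw [lintegral_const_mul _ (Finset.measurable_sum _ fun i _ => hgζ i),
    lintegral_finsetSum _ fun i _ => hgζ i]
  have : ∀ i, ∫⁻ ω, g (ζ i ω) ∂μ = ∫⁻ x, g x ∂P := fun i => by
    rw [← hlaw i, lintegral_map hg (hζ i)]
  simp only [this, Finset.sum_const, Finset.card_range, nsmul_eq_mul]
  rw [← mul_assoc, ENNReal.inv_mul_cancel (by positivity) (ENNReal.natCast_ne_top n), one_mul]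

theorem measurable_lintegral_empirical {Ω : Type*} [MeasurableSpace Ω]
    {ζ : ℕ → Ω → SkorokhodSpace T} (hζ : ∀ i, Measurable (ζ i)) (n : ℕ)
    {g : SkorokhodSpace T → ℝ≥0∞} (hg : Measurable g) :
    Measurable fun ω => ∫⁻ x, g x ∂empirical (fun i => ζ i ω) n := by
  simp only [lintegral_empirical _ _ hg]
  exact (Finset.measurable_sum _ fun i _ => hg.comp (hζ i)).const_mul _

/-- The product coupling is used with the triangle inequality through `a` and convexity of `t ↦ t ^
p`. The dominating integrand is a sum of functions of one coordinate each. -/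
theorem wasserstein_rpow_le_moments {p : ℝ} (hp : 1 ≤ p) (P Q : Measure (SkorokhodSpace T))
    [IsProbabilityMeasure P] [IsProbabilityMeasure Q] (a : SkorokhodSpace T) :
    wasserstein p P Q ^ p ≤
      2 ^ (p - 1) * (∫⁻ x, edist x a ^ p ∂P + ∫⁻ x, edist x a ^ p ∂Q) := by
  have hp0 : 0 < p := by linarith
  have hm : Measurable fun x : SkorokhodSpace T => edist x a ^ p :=
    (continuous_id.edist continuous_const).measurable.pow_const p
  refine (wasserstein_rpow_le hp0 (isCoupling_prod P Q)).trans ?_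
  calc ∫⁻ z, edist z.1 z.2 ^ p ∂P.prod Q
      ≤ ∫⁻ z, 2 ^ (p - 1) * (edist z.1 a ^ p + edist z.2 a ^ p) ∂P.prod Q := by
        refine lintegral_mono fun z => ?_
        refine (ENNReal.rpow_le_rpow (edist_triangle_right z.1 z.2 a) hp0.le).trans ?_
        exact ENNReal.rpow_add_le_mul_rpow_add_rpow _ _ hp
    _ = _ := by
        rw [lintegral_const_mul, lintegral_add_left]
        · congr 2
          · conv_rhs => rw [← Measure.fst_prod (μ := P) (ν := Q)]
            rw [Measure.fst, lintegral_map hm measurable_fst]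
          · conv_rhs => rw [← Measure.snd_prod (μ := P) (ν := Q)]
            rw [Measure.snd, lintegral_map hm measurable_snd]
        · exact hm.comp measurable_fst
        · exact (hm.comp measurable_fst).add (hm.comp measurable_snd)

theorem lintegral_wasserstein_empirical_le {p : ℝ} (hp : 1 ≤ p) {Ω : Type*} [MeasurableSpace Ω]
    {μ : Measure Ω} [IsProbabilityMeasure μ] {P : Measure (SkorokhodSpace T)}
    [IsProbabilityMeasure P] {ζ : ℕ → Ω → SkorokhodSpace T} (hζ : ∀ i, Measurable (ζ i))
    (hlaw : ∀ i, μ.map (ζ i) = P) {n : ℕ} (hn : 1 ≤ n) (a : SkorokhodSpace T) :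
    ∫⁻ ω, wasserstein p (empirical (fun i => ζ i ω) n) P ^ p ∂μ ≤
      2 ^ p * wasserstein p P (Measure.dirac a) ^ p := by
  have hp0 : 0 < p := by linarith
  have hm : Measurable fun x : SkorokhodSpace T => edist x a ^ p :=
    (continuous_id.edist continuous_const).measurable.pow_const p
  refine le_trans ?_ (mul_le_mul_right (lintegral_le_wasserstein_dirac hp0 P a) _)
  calc ∫⁻ ω, wasserstein p (empirical (fun i => ζ i ω) n) P ^ p ∂μ
      ≤ ∫⁻ ω, 2 ^ (p - 1) * (∫⁻ x, edist x a ^ p ∂empirical (fun i => ζ i ω) n +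
          ∫⁻ x, edist x a ^ p ∂P) ∂μ := by
        refine lintegral_mono fun ω => ?_
        have := isProbabilityMeasure_empirical (fun i => ζ i ω) hn
        exact wasserstein_rpow_le_moments hp _ _ a
    _ = 2 ^ (p - 1) * (∫⁻ x, edist x a ^ p ∂P + ∫⁻ x, edist x a ^ p ∂P) := by
        rw [lintegral_const_mul _ ((measurable_lintegral_empirical hζ n hm).add_const _),
          lintegral_add_right _ measurable_const, lintegral_const, measure_univ, mul_one,
          lintegral_lintegral_empirical hζ hlaw hn hm]
    _ = 2 ^ p * ∫⁻ x, edist x a ^ p ∂P := by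
        rw [← two_mul, ← mul_assoc]
        congr 1
        conv_lhs => rw [← ENNReal.rpow_one 2, ← ENNReal.rpow_mul, one_mul]
        rw [← ENNReal.rpow_add _ _ two_ne_zero ENNReal.ofNat_ne_top, sub_add_cancel]

/-! ### Couplings adapted to a finite partition -/

/-- A partial coupling extends to a coupling. -/
theorem exists_isCoupling_add {P Q : Measure (SkorokhodSpace T)} [IsProbabilityMeasure P]
    [IsProbabilityMeasure Q] {γ : Measure (SkorokhodSpace T × SkorokhodSpace T)}
    (hfst : γ.fst ≤ P) (hsnd : γ.snd ≤ Q) :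
    ∃ ρ : Measure (SkorokhodSpace T × SkorokhodSpace T),
      IsCoupling (γ + ρ) P Q ∧ ρ univ = 1 - γ univ := by
  have : IsFiniteMeasure γ.fst := isFiniteMeasure_of_le P hfst
  have : IsFiniteMeasure γ.snd := isFiniteMeasure_of_le Q hsnd
  set P' := P - γ.fst with hP'
  set Q' := Q - γ.snd with hQ'
  set r : ℝ≥0∞ := 1 - γ univ with hr
  have hPr : P' univ = r := by
    rw [hP', Measure.sub_apply MeasurableSet.univ hfst, measure_univ, Measure.fst_univ]
  have hQr : Q' univ = r := by
    rw [hQ', Measure.sub_apply MeasurableSet.univ hsnd, measure_univ, Measure.snd_univ]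
  have hr_top : r ≠ ∞ := ne_top_of_le_ne_top ENNReal.one_ne_top tsub_le_self
  -- The leftover marginals have equal mass `r`, so `r⁻¹ • P'.prod Q'` couples them. If `r = 0` then
  -- `r⁻¹ = ∞`, but both leftovers vanish.
  have hcancel : ∀ ν : Measure (SkorokhodSpace T), ν univ = r → r⁻¹ • r • ν = ν := by
    intro ν hν
    rcases eq_or_ne r 0 with h0 | h0
    · rw [h0, Measure.measure_univ_eq_zero] at hν
      simp [hν]
    · rw [smul_smul, ENNReal.inv_mul_cancel h0 hr_top, one_smul]
  have hρ1 : (r⁻¹ • P'.prod Q').fst = P' := by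
    rw [Measure.fst, Measure.map_smul, Measure.map_fst_prod, hQr, hcancel P' hPr]
  have hρ2 : (r⁻¹ • P'.prod Q').snd = Q' := by
    rw [Measure.snd, Measure.map_smul, Measure.map_snd_prod, hPr, hcancel Q' hQr]
  have h1 : (γ + r⁻¹ • P'.prod Q').fst = P := by
    rw [Measure.fst_add, hρ1, add_comm, Measure.sub_add_cancel_of_le hfst]
  have h2 : (γ + r⁻¹ • P'.prod Q').snd = Q := by
    rw [Measure.snd_add, hρ2, add_comm, Measure.sub_add_cancel_of_le hsnd]
  refine ⟨r⁻¹ • P'.prod Q', ⟨⟨?_⟩, h1, h2⟩, ?_⟩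
  · rw [← Measure.fst_univ, h1, measure_univ]
  · rw [← Measure.fst_univ, hρ1, hPr]

/-- The part of the mass that can be coupled inside the fibres of a simple function. -/
theorem exists_partial_coupling_fibres (P Q : Measure (SkorokhodSpace T)) [IsProbabilityMeasure P]
    [IsProbabilityMeasure Q] (f : SimpleFunc (SkorokhodSpace T) (SkorokhodSpace T)) :
    ∃ γ : Measure (SkorokhodSpace T × SkorokhodSpace T), γ.fst ≤ P ∧ γ.snd ≤ Q ∧
      (∀ᵐ z ∂γ, f z.1 = f z.2) ∧
      1 - γ univ ≤ ∑ a ∈ f.range, (Q (f ⁻¹' {a}) - P (f ⁻¹' {a})) := by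
  let A : SkorokhodSpace T → Set (SkorokhodSpace T) := fun a => f ⁻¹' {a}
  have hA : ∀ a, MeasurableSet (A a) := fun a => f.measurableSet_fiber a
  -- This factor gives the product measure on each fibre the mass `min (P (A a)) (Q (A a))`, the
  -- most that a coupling can keep there. On a fibre null for `P` or `Q` the minimum is `0`, hence
  -- so is `c a`, because `0 * ∞ = 0`.
  let c : SkorokhodSpace T → ℝ≥0∞ := fun a => min (P (A a)) (Q (A a)) * (P (A a))⁻¹ * (Q (A a))⁻¹
  have hsum : ∀ ν : Measure (SkorokhodSpace T), ∑ a ∈ f.range, ν.restrict (A a) = ν := by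
    intro ν
    ext B hB
    rw [Measure.finsetSum_apply]
    simp only [Measure.restrict_apply hB]
    rw [← Measure.restrict_apply_univ B, ← f.sum_range_measure_preimage_singleton (ν.restrict B)]
    exact Finset.sum_congr rfl fun a _ => by rw [Measure.restrict_apply (hA a), inter_comm]
  have hcP : ∀ a, c a * Q (A a) ≤ 1 := fun a => by
    calc c a * Q (A a) ≤ P (A a) * (P (A a))⁻¹ * ((Q (A a))⁻¹ * Q (A a)) := by
          rw [← mul_assoc]; simp only [c]; gcongr; exact min_le_left _ _
      _ ≤ 1 * 1 := mul_le_mul' (ENNReal.mul_inv_le_one _) (ENNReal.inv_mul_le_one _)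
      _ = 1 := one_mul 1
  have hcQ : ∀ a, c a * P (A a) ≤ 1 := fun a => by
    calc c a * P (A a) = min (P (A a)) (Q (A a)) * (Q (A a))⁻¹ * ((P (A a))⁻¹ * P (A a)) := by
          simp only [c]; ring
      _ ≤ Q (A a) * (Q (A a))⁻¹ * ((P (A a))⁻¹ * P (A a)) := by gcongr; exact min_le_right _ _
      _ ≤ 1 * 1 := mul_le_mul' (ENNReal.mul_inv_le_one _) (ENNReal.inv_mul_le_one _)
      _ = 1 := one_mul 1
  have hmass : ∀ a, c a * (P (A a) * Q (A a)) = min (P (A a)) (Q (A a)) := fun a => by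
    rcases eq_or_ne (P (A a)) 0 with h0 | h0
    · simp [h0]
    rcases eq_or_ne (Q (A a)) 0 with h1 | h1
    · simp [h1]
    calc c a * (P (A a) * Q (A a))
        = min (P (A a)) (Q (A a)) * ((P (A a))⁻¹ * P (A a)) * ((Q (A a))⁻¹ * Q (A a)) := by
          simp only [c]; ring
      _ = _ := by
          rw [ENNReal.inv_mul_cancel h0 (measure_ne_top _ _),
            ENNReal.inv_mul_cancel h1 (measure_ne_top _ _), mul_one, mul_one]
  have hle : ∀ (b : SkorokhodSpace T → ℝ≥0∞) (ν : Measure (SkorokhodSpace T)), (∀ a, b a ≤ 1) →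
      ∑ a ∈ f.range, b a • ν.restrict (A a) ≤ ν := by
    intro b ν hb
    conv_rhs => rw [← hsum ν]
    refine Finset.sum_le_sum fun a _ => ?_
    refine Measure.le_iff.2 fun B _ => ?_
    rw [Measure.smul_apply, smul_eq_mul]
    exact mul_le_of_le_one_left' (hb a)
  refine ⟨∑ a ∈ f.range, c a • (P.restrict (A a)).prod (Q.restrict (A a)), ?_, ?_, ?_, ?_⟩
  · refine le_trans (le_of_eq ?_) (hle _ P hcP)
    ext B hB
    rw [Measure.fst_apply hB, Measure.finsetSum_apply, Measure.finsetSum_apply]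
    refine Finset.sum_congr rfl fun a _ => ?_
    rw [Measure.smul_apply, ← Measure.map_apply measurable_fst hB, Measure.map_fst_prod,
      Measure.restrict_apply_univ, Measure.smul_apply, Measure.smul_apply, smul_smul]
  · refine le_trans (le_of_eq ?_) (hle _ Q hcQ)
    ext B hB
    rw [Measure.snd_apply hB, Measure.finsetSum_apply, Measure.finsetSum_apply]
    refine Finset.sum_congr rfl fun a _ => ?_
    rw [Measure.smul_apply, ← Measure.map_apply measurable_snd hB, Measure.map_snd_prod,
      Measure.restrict_apply_univ, Measure.smul_apply, Measure.smul_apply, smul_smul]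
  · rw [ae_iff, Measure.finsetSum_apply]
    refine Finset.sum_eq_zero fun a _ => ?_
    rw [Measure.smul_apply, Measure.prod_restrict]
    have : (P.prod Q).restrict (A a ×ˢ A a) {z | ¬ f z.1 = f z.2} = 0 := by
      rw [← ae_iff]
      refine ae_restrict_of_forall_mem ((hA a).prod (hA a)) fun z hz => ?_
      have h1 : f z.1 = a := hz.1
      have h2 : f z.2 = a := hz.2
      rw [h1, h2]
    rw [this, smul_zero]
  · have hQ1 : ∑ a ∈ f.range, Q (A a) = 1 := by
      rw [f.sum_range_measure_preimage_singleton Q, measure_univ]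
    have hγ : (∑ a ∈ f.range, c a • (P.restrict (A a)).prod (Q.restrict (A a))) univ =
        ∑ a ∈ f.range, min (P (A a)) (Q (A a)) := by
      rw [Measure.finsetSum_apply]
      refine Finset.sum_congr rfl fun a _ => ?_
      rw [Measure.smul_apply, ← univ_prod_univ, Measure.prod_prod, Measure.restrict_apply_univ,
        Measure.restrict_apply_univ, smul_eq_mul, hmass]
    -- The uncoupled mass is controlled by `Q - min P Q` on each fibre, which is the truncated
    -- difference `Q - P`.
    rw [hγ, tsub_le_iff_right, ← hQ1, ← Finset.sum_add_distrib]
    refine Finset.sum_le_sum fun a _ => ?_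
    rcases le_total (P (A a)) (Q (A a)) with h | h
    · rw [min_eq_left h]; exact le_tsub_add
    · rw [min_eq_right h]; exact le_add_self

theorem rpow_add_add_le (a b c : ℝ≥0∞) {p : ℝ} (hp : 0 ≤ p) :
    (a + b + c) ^ p ≤ 3 ^ p * (a ^ p + b ^ p + c ^ p) := by
  have h : a + b + c ≤ 3 * max (max a b) c := by
    calc a + b + c ≤ max (max a b) c + max (max a b) c + max (max a b) c :=
          add_le_add (add_le_add ((le_max_left _ _).trans (le_max_left _ _))
            ((le_max_right _ _).trans (le_max_left _ _))) (le_max_right _ _)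
      _ = 3 * max (max a b) c := by ring
  refine (ENNReal.rpow_le_rpow h hp).trans ?_
  rw [ENNReal.mul_rpow_of_nonneg _ _ hp]
  refine mul_le_mul_right ?_ _
  rcases max_choice (max a b) c with h1 | h1 <;> rw [h1]
  · rcases max_choice a b with h2 | h2 <;> rw [h2]
    · exact le_self_add.trans le_self_add
    · exact le_add_self.trans le_self_add
  · exact le_add_self

/-! ### Convergence in mean -/

/-- The law of large numbers for the empirical measure of a set. -/
theorem ae_tendsto_empirical_apply {Ω : Type*} [MeasurableSpace Ω] {μ : Measure Ω}
    [IsProbabilityMeasure μ] {P : Measure (SkorokhodSpace T)} [IsProbabilityMeasure P]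
    {ζ : ℕ → Ω → SkorokhodSpace T} (hζ : ∀ i, Measurable (ζ i))
    (hindep : ProbabilityTheory.iIndepFun ζ μ) (hlaw : ∀ i, μ.map (ζ i) = P)
    {A : Set (SkorokhodSpace T)} (hA : MeasurableSet A) :
    ∀ᵐ ω ∂μ, Tendsto (fun n => empirical (fun i => ζ i ω) n A) atTop (𝓝 (P A)) := by
  have hg : Measurable (A.indicator (1 : SkorokhodSpace T → ℝ)) := measurable_one.indicator hA
  have hident : ∀ i, ProbabilityTheory.IdentDistrib (ζ i) (ζ 0) μ μ := fun i =>
    ⟨(hζ i).aemeasurable, (hζ 0).aemeasurable, by rw [hlaw, hlaw]⟩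
  have hint : Integrable (fun ω => A.indicator (1 : SkorokhodSpace T → ℝ) (ζ 0 ω)) μ := by
    have : Integrable (((ζ 0) ⁻¹' A).indicator (1 : Ω → ℝ)) μ :=
      (integrable_const (1 : ℝ)).indicator (hζ 0 hA)
    exact this
  have hval : ∫ ω, A.indicator (1 : SkorokhodSpace T → ℝ) (ζ 0 ω) ∂μ = P.real A := by
    rw [← hlaw 0, map_measureReal_apply (hζ 0) hA]
    exact integral_indicator_one (hζ 0 hA)
  have hlln := ProbabilityTheory.strong_law_ae_real
    (fun i ω => A.indicator (1 : SkorokhodSpace T → ℝ) (ζ i ω)) hint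
    (fun i j hij => (hindep.indepFun hij).comp hg hg) (fun i => (hident i).comp hg)
  filter_upwards [hlln] with ω hω
  rw [hval] at hω
  have := ENNReal.tendsto_ofReal hω
  rw [ofReal_measureReal] at this
  refine this.congr' ?_
  filter_upwards [eventually_ge_atTop 1] with n hn
  have hn0 : (0 : ℝ) < n := by exact_mod_cast hn
  rw [empirical_apply _ _ hA, ENNReal.ofReal_div_of_pos hn0, ENNReal.ofReal_natCast,
    ENNReal.div_eq_inv_mul, ENNReal.ofReal_sum_of_nonneg fun i _ =>
      show 0 ≤ A.indicator (1 : SkorokhodSpace T → ℝ) (ζ i ω) from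
        indicator_nonneg (fun _ _ => zero_le_one) _]
  congr 1
  refine Finset.sum_congr rfl fun i _ => ?_
  by_cases h : ζ i ω ∈ A <;> simp [h]

/-- The one-sided difference is what the fibrewise coupling leaves over. It is at most `1`, so
almost sure convergence passes to the mean. -/
theorem tendsto_lintegral_measure_sub_empirical {Ω : Type*} [MeasurableSpace Ω] {μ : Measure Ω}
    [IsProbabilityMeasure μ] {P : Measure (SkorokhodSpace T)} [IsProbabilityMeasure P]
    {ζ : ℕ → Ω → SkorokhodSpace T} (hζ : ∀ i, Measurable (ζ i))
    (hindep : ProbabilityTheory.iIndepFun ζ μ) (hlaw : ∀ i, μ.map (ζ i) = P)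
    {A : Set (SkorokhodSpace T)} (hA : MeasurableSet A) :
    Tendsto (fun n => ∫⁻ ω, (P A - empirical (fun i => ζ i ω) n A) ∂μ) atTop (𝓝 0) := by
  have h0 : (0 : ℝ≥0∞) = ∫⁻ _, 0 ∂μ := by simp
  rw [h0]
  refine tendsto_lintegral_of_dominated_convergence (fun _ => 1) (fun n => ?_)
    (fun n => Eventually.of_forall fun ω => tsub_le_self.trans prob_le_one) (by simp) ?_
  · have := measurable_lintegral_empirical hζ n (measurable_one.indicator hA)
    simp only [lintegral_indicator_one hA] at this
    exact measurable_const.sub this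
  · filter_upwards [ae_tendsto_empirical_apply hζ hindep hlaw hA] with ω hω
    have := ENNReal.Tendsto.sub (tendsto_const_nhds (x := P A)) hω
      (Or.inl (measure_ne_top P A))
    rwa [tsub_self] at this

section SecondCountable

variable [SecondCountableTopology (SkorokhodSpace T)]

/-- The path from `x` to `y` goes through `f x` and `f y`. The outer legs depend on one marginal
each; the middle leg is free on the part coupled within fibres and costs at most `M` on the rest. -/
theorem wasserstein_rpow_le_of_simpleFunc {p : ℝ} (hp : 0 < p) (P Q : Measure (SkorokhodSpace T))
    [IsProbabilityMeasure P] [IsProbabilityMeasure Q]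
    (f : SimpleFunc (SkorokhodSpace T) (SkorokhodSpace T)) {M : ℝ≥0∞}
    (hM : ∀ x y, edist (f x) (f y) ≤ M) :
    wasserstein p P Q ^ p ≤ 3 ^ p * (∫⁻ x, edist (f x) x ^ p ∂P + ∫⁻ x, edist (f x) x ^ p ∂Q +
      M ^ p * ∑ a ∈ f.range, (Q (f ⁻¹' {a}) - P (f ⁻¹' {a}))) := by
  obtain ⟨γ, hγ1, hγ2, hγf, hγr⟩ := exists_partial_coupling_fibres P Q f
  obtain ⟨ρ, hρ, hρr⟩ := exists_isCoupling_add hγ1 hγ2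
  have hm : Measurable fun x : SkorokhodSpace T => edist (f x) x ^ p :=
    (f.measurable.edist measurable_id).pow_const p
  have hm2 : Measurable fun z : SkorokhodSpace T × SkorokhodSpace T =>
      edist (f z.1) (f z.2) ^ p :=
    ((f.measurable.comp measurable_fst).edist (f.measurable.comp measurable_snd)).pow_const p
  refine (wasserstein_rpow_le hp hρ).trans ?_
  calc ∫⁻ z, edist z.1 z.2 ^ p ∂(γ + ρ)
      ≤ ∫⁻ z, 3 ^ p * (edist (f z.1) z.1 ^ p + edist (f z.2) z.2 ^ p +
          edist (f z.1) (f z.2) ^ p) ∂(γ + ρ) := by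
        refine lintegral_mono fun z => ?_
        refine le_trans (ENNReal.rpow_le_rpow ?_ hp.le) (rpow_add_add_le _ _ _ hp.le)
        calc edist z.1 z.2 ≤ edist z.1 (f z.1) + edist (f z.1) (f z.2) + edist (f z.2) z.2 :=
              edist_triangle4 _ _ _ _
          _ = _ := by rw [edist_comm z.1]; ring
    _ = 3 ^ p * (∫⁻ x, edist (f x) x ^ p ∂P + ∫⁻ x, edist (f x) x ^ p ∂Q +
          ∫⁻ z, edist (f z.1) (f z.2) ^ p ∂(γ + ρ)) := by
        have hm1 : Measurable fun z : SkorokhodSpace T × SkorokhodSpace T =>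
          edist (f z.1) z.1 ^ p := hm.comp measurable_fst
        have hm1' : Measurable fun z : SkorokhodSpace T × SkorokhodSpace T =>
          edist (f z.2) z.2 ^ p := hm.comp measurable_snd
        rw [lintegral_const_mul _ (by fun_prop), lintegral_add_right _ hm2,
          lintegral_add_left hm1]
        congr 3
        · conv_rhs => rw [← hρ.fst_eq]
          rw [Measure.fst, lintegral_map hm measurable_fst]
        · conv_rhs => rw [← hρ.snd_eq]
          rw [Measure.snd, lintegral_map hm measurable_snd]
    _ ≤ _ := by
        gcongr
        have h0 : ∫⁻ z, edist (f z.1) (f z.2) ^ p ∂γ = 0 := by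
          rw [lintegral_congr_ae (g := fun _ => 0) (hγf.mono fun z hz => by
            simp [hz, ENNReal.zero_rpow_of_pos hp])]
          simp
        rw [lintegral_add_measure, h0, zero_add]
        calc ∫⁻ z, edist (f z.1) (f z.2) ^ p ∂ρ ≤ ∫⁻ _, M ^ p ∂ρ :=
              lintegral_mono fun z => ENNReal.rpow_le_rpow (hM _ _) hp.le
          _ = M ^ p * (1 - γ univ) := by rw [lintegral_const, hρr]
          _ ≤ _ := by gcongr

/-- Simple functions approximate the identity in `p`-th mean. -/
theorem tendsto_lintegral_edist_approxOn {p : ℝ} (hp : 0 < p) {P : Measure (SkorokhodSpace T)}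
    (hP : FiniteMoment p P) :
    Tendsto (fun k => ∫⁻ x, edist (SimpleFunc.approxOn id measurable_id univ
      (0 : SkorokhodSpace T) (mem_univ _) k x) x ^ p ∂P) atTop (𝓝 0) := by
  have h0 : (0 : ℝ≥0∞) = ∫⁻ _, 0 ∂P := by simp
  rw [h0]
  refine tendsto_lintegral_of_dominated_convergence (fun x => edist x 0 ^ p) (fun k => ?_)
    (fun k => ?_) (ne_of_lt hP) ?_
  · exact ((SimpleFunc.measurable _).edist measurable_id).pow_const p
  -- The approximation starts from the base point `0` and never does worse, so the moment of `P`
  -- dominates.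
  · refine Eventually.of_forall fun x => ENNReal.rpow_le_rpow ?_ hp.le
    rw [edist_comm x 0]
    exact SimpleFunc.edist_approxOn_le measurable_id (mem_univ _) x k
  · refine Eventually.of_forall fun x => ?_
    have h1 := SimpleFunc.tendsto_approxOn (f := id) (measurable_id (α := SkorokhodSpace T))
      (mem_univ (0 : SkorokhodSpace T)) (x := x) (by simp)
    have h2 := (ENNReal.continuous_rpow_const (y := p)).tendsto 0
    rw [ENNReal.zero_rpow_of_pos hp] at h2
    refine h2.comp ?_
    exact tendsto_iff_edist_tendsto_0.1 h1

/-- **Glivenko–Cantelli in mean** for the Wasserstein distance. -/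
theorem tendsto_lintegral_wasserstein_empirical {p : ℝ} (hp : 0 < p) {Ω : Type*}
    [MeasurableSpace Ω] {μ : Measure Ω} [IsProbabilityMeasure μ] {P : Measure (SkorokhodSpace T)}
    [IsProbabilityMeasure P] (hP : FiniteMoment p P) {ζ : ℕ → Ω → SkorokhodSpace T}
    (hζ : ∀ i, Measurable (ζ i)) (hindep : ProbabilityTheory.iIndepFun ζ μ)
    (hlaw : ∀ i, μ.map (ζ i) = P) :
    Tendsto (fun n => ∫⁻ ω, wasserstein p (empirical (fun i => ζ i ω) n) P ^ p ∂μ)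
      atTop (𝓝 0) := by
  refine ENNReal.tendsto_nhds_zero.2 fun ε hε => ?_
  have h3 : (3 : ℝ≥0∞) ^ p ≠ ∞ := ENNReal.rpow_ne_top_of_nonneg hp.le ENNReal.ofNat_ne_top
  -- One summand stands for the rounding error of `P`, the other for that of the empirical measure,
  -- whose expectation is the same for every `n ≥ 1`. Hence `k` can be fixed before `n`.
  have hsmall : Tendsto (fun k => (3 : ℝ≥0∞) ^ p *
      (∫⁻ x, edist (SimpleFunc.approxOn id measurable_id univ
        (0 : SkorokhodSpace T) (mem_univ _) k x) x ^ p ∂P +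
      ∫⁻ x, edist (SimpleFunc.approxOn id measurable_id univ
        (0 : SkorokhodSpace T) (mem_univ _) k x) x ^ p ∂P)) atTop (𝓝 0) := by
    have h := tendsto_lintegral_edist_approxOn hp hP
    simpa using ENNReal.Tendsto.const_mul (h.add h) (Or.inr h3)
  obtain ⟨k, hk⟩ := (hsmall.eventually (gt_mem_nhds hε)).exists
  set f := SimpleFunc.approxOn id measurable_id univ (0 : SkorokhodSpace T) (mem_univ _) k
  -- A simple function has finite range, so its diameter bounds the middle leg.
  obtain ⟨M, hMtop, hM⟩ : ∃ M : ℝ≥0∞, M ≠ ∞ ∧ ∀ x y, edist (f x) (f y) ≤ M :=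
    ⟨Metric.ediam (f.range : Set (SkorokhodSpace T)),
      (Metric.isBounded_iff_ediam_ne_top.1 f.range.finite_toSet.isBounded), fun x y =>
      Metric.edist_le_ediam_of_mem (by simp) (by simp)⟩
  have hm : Measurable fun x : SkorokhodSpace T => edist (f x) x ^ p :=
    (f.measurable.edist measurable_id).pow_const p
  have hdiff : ∀ n a, Measurable fun ω =>
      P (f ⁻¹' {a}) - empirical (fun i => ζ i ω) n (f ⁻¹' {a}) := by
    intro n a
    have := measurable_lintegral_empirical hζ n
      (measurable_one.indicator (f.measurableSet_fiber a))
    simp only [lintegral_indicator_one (f.measurableSet_fiber a)] at this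
    exact measurable_const.sub this
  have hlim : Tendsto (fun n : ℕ => (3 : ℝ≥0∞) ^ p * (∫⁻ x, edist (f x) x ^ p ∂P +
      ∫⁻ x, edist (f x) x ^ p ∂P + M ^ p * ∑ a ∈ f.range,
        ∫⁻ ω, (P (f ⁻¹' {a}) - empirical (fun i => ζ i ω) n (f ⁻¹' {a})) ∂μ)) atTop
      (𝓝 (3 ^ p * (∫⁻ x, edist (f x) x ^ p ∂P + ∫⁻ x, edist (f x) x ^ p ∂P))) := by
    have hsum := tendsto_finsetSum f.range fun a _ =>
      tendsto_lintegral_measure_sub_empirical hζ hindep hlaw (f.measurableSet_fiber a)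
    have h1 := ENNReal.Tendsto.const_mul (a := M ^ p) hsum
      (Or.inr (ENNReal.rpow_ne_top_of_nonneg hp.le hMtop))
    simp only [Finset.sum_const_zero, mul_zero] at h1
    simpa using ENNReal.Tendsto.const_mul (tendsto_const_nhds.add h1) (Or.inr h3)
  filter_upwards [hlim.eventually (gt_mem_nhds hk), eventually_ge_atTop 1] with n hn hn1
  refine le_trans ?_ hn.le
  calc ∫⁻ ω, wasserstein p (empirical (fun i => ζ i ω) n) P ^ p ∂μ
      ≤ ∫⁻ ω, 3 ^ p * (∫⁻ x, edist (f x) x ^ p ∂empirical (fun i => ζ i ω) n +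
          ∫⁻ x, edist (f x) x ^ p ∂P + M ^ p * ∑ a ∈ f.range,
            (P (f ⁻¹' {a}) - empirical (fun i => ζ i ω) n (f ⁻¹' {a}))) ∂μ := by
        refine lintegral_mono fun ω => ?_
        have := isProbabilityMeasure_empirical (fun i => ζ i ω) hn1
        exact wasserstein_rpow_le_of_simpleFunc hp _ _ f hM
    _ = _ := by
        have hm1 := measurable_lintegral_empirical hζ n hm
        have hm2 : Measurable fun ω => ∑ a ∈ f.range,
            (P (f ⁻¹' {a}) - empirical (fun i => ζ i ω) n (f ⁻¹' {a})) :=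
          Finset.measurable_sum _ fun a _ => hdiff n a
        rw [lintegral_const_mul _ (by fun_prop),
          lintegral_add_right _ (hm2.const_mul _), lintegral_add_right _ measurable_const,
          lintegral_const_mul _ hm2, lintegral_finsetSum _ fun a _ => hdiff n a,
          lintegral_const, measure_univ, mul_one, lintegral_lintegral_empirical hζ hlaw hn1 hm]

end SecondCountable

end SkorokhodSpace

theorem lemma4p1 {T : ℝ} (hT : 0 < T) {p : ℝ} (hp : 1 ≤ p)
    {Ω : Type*} [MeasurableSpace Ω] (μ : Measure Ω) [IsProbabilityMeasure μ]
    (P : Measure (SkorokhodSpace T)) [IsProbabilityMeasure P]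
    (hP : SkorokhodSpace.FiniteMoment p P)
    (ζ : ℕ → Ω → SkorokhodSpace T) (hmeas : ∀ i, Measurable (ζ i))
    (hindep : ProbabilityTheory.iIndepFun ζ μ) (hlaw : ∀ i, μ.map (ζ i) = P) :
    (∀ n : ℕ, 1 ≤ n →
      Measurable (fun ω =>
        SkorokhodSpace.wasserstein p (SkorokhodSpace.empirical (fun i => ζ i ω) n) P) ∧
      ∫⁻ ω, SkorokhodSpace.wasserstein p
          (SkorokhodSpace.empirical (fun i => ζ i ω) n) P ^ p ∂μ
        ≤ 2 ^ p * SkorokhodSpace.wasserstein p P (Measure.dirac 0) ^ p) ∧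
    Tendsto
      (fun n : ℕ => ∫⁻ ω, SkorokhodSpace.wasserstein p
        (SkorokhodSpace.empirical (fun i => ζ i ω) n) P ^ p ∂μ)
      atTop (𝓝 0) := by
  have := SkorokhodSpace.secondCountableTopology hT
  exact ⟨fun n hn => ⟨SkorokhodSpace.measurable_wasserstein_empirical hp P hmeas n,
    SkorokhodSpace.lintegral_wasserstein_empirical_le hp hmeas hlaw hn 0⟩,
    SkorokhodSpace.tendsto_lintegral_wasserstein_empirical (by linarith) hP hmeas hindep hlaw⟩
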